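/- A nonlocal game is a tuple $G=(\mathcal X,\mathcal A,\mu,D)$ with a finite question set $\mathcal X$, a finite nonempty answer set $\mathcal A$, a probability distribution $\mu$ on $\mathcal X\times\mathcal X$ with rational values, and a decision predicate $D:\mathcal X\times\mathcal X\times\mathcal A\times\mathcal A\to\{0,1\}$; it is described by the finite tables of $\mu$ and $D$. Its commuting operator value is $$\omega_{co}(G)=\sup\ \sum_{x,y\in\mathcal X}\sum_{a,b\in\mathcal A}\mu(x,y)\,\langle\psi|A^x_aB^y_b|\psi\rangle\,D(x,y,a,b),$$ the supremum being over all separable complex Hilbert spaces $\mathcal H$, unit vectors $\psi\in\mathcal H$, and families of POVMs $\{A^x_a\}_{a\in\mathcal A}$ and $\{B^y_b\}_{b\in\mathcal A}$ of bounded positive operators on $\mathcal H$ (each summing to the identity) such that every $A^x_a$ commutes with every $B^y_b$. Let $\mathcal K$ be either the class of all nonlocal games, or the class of those that are synchronous ($D(x,x,a,b)=1$ if and only if $a=b$) and whose question distribution $\mu$ is uniform on $\mathcal X\times\mathcal X$. A language $L\subseteq\mathbb N$ is in $\Pi_1$ if there is a computable predicate $\varphi$ with $n\in L\iff\forall x\in\mathbb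 N\ \varphi(n,x)$. The approximate (resp. exact) $co$-value problem for $\mathcal K$ is the problem of deciding, for $G\in\mathcal K$, whether $\omega_{co}(G)=1$ or $\omega_{co}(G)<\frac12$ (resp. $\omega_{co}(G)<1$). It is $\Pi_1$-hard if for every $\Pi_1$ language $L$ there is a computable map $n\mapsto G^{(n)}\in\mathcal K$ such that $\omega_{co}(G^{(n)})=1$ if $n\in L$, and $\omega_{co}(G^{(n)})<\frac12$ (resp. $<1$) if $n\notin L$. A description of a sequence of games $\mathscr G=(G_n)_{n\in\mathbb N}$ is a program that on input $n$ outputs the description of $G_n$. 1. Assume that the approximate $co$-value problem for $\mathcal K$ is $\Pi_1$-hard. Then there is a computable map $\mathsf{GapCompress}_{co}$ that takes as input a description of a sequence $\mathscr G=(G_n)_{n\in\mathbb N}$ of nonlocal games and outputs the description of a single game $G'\in\mathcal K$ such that $\omega_{co}(G')=1$ if $\omega_{co}(G_n)=1$ for every $n\in\mathbb N$, and $\omega_{co}(G')<\frac12$ otherwise. 2. Assume that the exact $co$-value problem for $\mathcal K$ is $\Pi_1$-hard. Then there is a computable map $\mathsf{GaplessCompress}_{co}$ that takes as input a description of a sequence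 $\mathscr G=(G_n)_{n\in\mathbb N}$ of nonlocal games and outputs the description of a single game $G'\in\mathcal K$ such that $\omega_{co}(G')=1$ if and only if $\omega_{co}(G_n)=1$ for all $n\in\mathbb N$. -/

import Mathlib

noncomputable section

namespace NonlocalGames

/-- A nonlocal game `(𝒳, 𝒜, μ, D)` with question set `𝒳 = {0, …, numQ - 1}`, answer set
`𝒜 = {0, …, numA - 1}`, a (rational) probability distribution `μ` on `𝒳 × 𝒳` and a decision
predicate `D : 𝒳 × 𝒳 × 𝒜 × 𝒜 → {0, 1}`. -/
structure Game where
  numQ : ℕ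
  numA : ℕ
  numA_pos : 0 < numA
  μ : Fin numQ → Fin numQ → ℚ
  μ_nonneg : ∀ x y, 0 ≤ μ x y
  μ_sum : ∑ x, ∑ y, μ x y = 1
  D : Fin numQ → Fin numQ → Fin numA → Fin numA → Bool

/-- A commuting operator strategy for `G` on the Hilbert space `H`: a unit vector together with
POVMs `A x`, `B y` such that the operators `A x a` and `B y b` commute. -/
structure Strategy (G : Game) (H : Type) [NormedAddCommGroup H] [InnerProductSpace ℂ H] where
  ψ : H
  norm_ψ : ‖ψ‖ = 1
  A : Fin G.numQ → Fin G.numA → (H →L[ℂ] H)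
  B : Fin G.numQ → Fin G.numA → (H →L[ℂ] H)
  A_pos : ∀ x a, (A x a).IsPositive
  B_pos : ∀ y b, (B y b).IsPositive
  A_sum : ∀ x, ∑ a, A x a = 1
  B_sum : ∀ y, ∑ b, B y b = 1
  comm : ∀ x y a b, Commute (A x a) (B y b)

/-- The value `ω(G, S) = ∑ μ(x, y) ⟨ψ, A x a (B y b ψ)⟩ D(x, y, a, b)`; the inner products are
nonnegative reals, so nothing is lost by taking real parts. -/
def Strategy.value {G : Game} {H : Type} [NormedAddCommGroup H] [InnerProductSpace ℂ H]
    (S : Strategy G H) : ℝ :=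
  ∑ x, ∑ y, ∑ a, ∑ b,
    (G.μ x y : ℝ) * (inner ℂ S.ψ ((S.A x a * S.B y b) S.ψ)).re * (if G.D x y a b then 1 else 0)

/-- The commuting operator value `ω_co(G)`: the supremum of the values of all commuting operator
strategies on separable complex Hilbert spaces. -/
def Game.coValue (G : Game) : ℝ :=
  sSup {v : ℝ | ∃ (H : Type) (_ : NormedAddCommGroup H) (_ : InnerProductSpace ℂ H)
    (_ : CompleteSpace H) (_ : TopologicalSpace.SeparableSpace H) (S : Strategy G H),
    v = S.value}

/-- Finite data describing a game: sizes of the question and answer sets, the table of `μ`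
(numerator and denominator of each entry), and the table of `D`. -/
abbrev GameDesc : Type :=
  ℕ × ℕ × List (List (ℕ × ℕ)) × List (List (List (List Bool)))

/-- The description of a game. -/
def Game.desc (G : Game) : GameDesc :=
  (G.numQ, G.numA,
    List.ofFn fun x => List.ofFn fun y => ((G.μ x y).num.toNat, (G.μ x y).den),
    List.ofFn fun x => List.ofFn fun y => List.ofFn fun a => List.ofFn fun b => G.D x y a b)

/-- A game-valued map is computable if the description of its output is computable from
the input. -/
def ComputableToGames {α : Type} [Primcodable α] (f : α → Game) : Prop :=
  Computable fun a => (f a).desc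

/-- The program `c` describes the sequence of games `𝒢 = (𝒢 n)_n`: on every input `n` it halts
and outputs (the code of) the description of `𝒢 n`. -/
def DescribesSeq (c : Nat.Partrec.Code) (𝒢 : ℕ → Game) : Prop :=
  ∀ n, c.eval n = Part.some (Encodable.encode (𝒢 n).desc)

/-- `L` is a `Π₁` language: membership of `n` is a sentence `∀ x, φ(n, x)`, with `φ` a computable
predicate. -/
def IsPiOne (L : Set ℕ) : Prop :=
  ∃ φ : ℕ → ℕ → Prop, ComputablePred (fun q : ℕ × ℕ => φ q.1 q.2) ∧
    ∀ n, n ∈ L ↔ ∀ x, φ n x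

/-- The promise problem with yes-instances `yes` and no-instances `no` is `Π₁`-hard: every `Π₁`
language has a computable many-one reduction to it. -/
def IsPiOneHard (yes no : Set Game) : Prop :=
  ∀ L : Set ℕ, IsPiOne L → ∃ f : ℕ → Game, ComputableToGames f ∧
    ∀ n, (n ∈ L → f n ∈ yes) ∧ (n ∉ L → f n ∈ no)

/-- Yes-instances of the `co`-value problems, for games from the class `𝒦`. -/
def coYes (𝒦 : Set Game) : Set Game := {G | G ∈ 𝒦 ∧ G.coValue = 1}

/-- No-instances of the `co`-value problem with gap `ε`, for games from the class `𝒦`. -/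
def coNo (𝒦 : Set Game) (ε : ℝ) : Set Game := {G | G ∈ 𝒦 ∧ G.coValue < 1 - ε}

/-- The approximate `co`-value problem for games from `𝒦` (decide whether `ω_co = 1` or
`ω_co < 1/2`) is `Π₁`-hard. -/
def ApproxCoValuePiOneHard (𝒦 : Set Game) : Prop := IsPiOneHard (coYes 𝒦) (coNo 𝒦 (1 / 2))

/-- The exact `co`-value problem for games from `𝒦` (decide whether `ω_co = 1` or `ω_co < 1`) is
`Π₁`-hard. -/
def ExactCoValuePiOneHard (𝒦 : Set Game) : Prop := IsPiOneHard (coYes 𝒦) (coNo 𝒦 0)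

/-- `G` is synchronous: on equal questions exactly the equal answers win. -/
def Game.IsSynchronous (G : Game) : Prop :=
  ∀ x a b, G.D x x a b = true ↔ a = b

/-- The question distribution of `G` is uniform. -/
def Game.IsUniform (G : Game) : Prop :=
  ∀ x y, G.μ x y = 1 / ((G.numQ : ℚ) * G.numQ)

end NonlocalGames

end

/-! ### Signed sums and positive semidefinite kernels -/

noncomputable section

namespace NonlocalGames

open scoped ComplexOrder ComplexConjugate
open Filter Topology

/-! The heart of the matter is that "`ω_co(G) = 1`" is a `Π₁` property of the description of `G`.
Then so is "every game of the sequence has value one", as a property of the program. Applying the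
assumed hardness to this one language gives a reduction, and composing it with the encoding of
programs gives the compression map (`exists_compress`).

To see that value one is `Π₁`, replace strategies by their moments, the real parts of `⟨ψ, w ψ⟩` for
words `w` in the POVM elements. Moments satisfy a countable family of linear inequalities that are
computable from the description of the game. Strategies of value close to one satisfy all of them up
to a small error (`exists_isMoment_of_coValue`). Conversely, a functional on words satisfying them
exactly comes from a perfect strategy, by a GNS construction (`coValue_eq_one_of_isMoment`).

The two are joined by compactness. Rounding approximate moments gives, for each `N`, a finite table
satisfying the first `N` inequalities up to an error of order `1 / N` (`hasTable_of_isMoment`).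
Tables of all sizes have a limit point in a product of intervals, which satisfies the inequalities
exactly (`exists_isMoment_of_hasTable`). Existence of a table of given size is decided by finite
search, so value one is a universal statement over `N` with a decidable matrix
(`coValue_eq_one_iff`, `primrecRel_hasTable`). -/

/-- The sign `±1` encoded by a Boolean. -/
def sgn (s : Bool) : ℝ := if s then 1 else -1

/-- The value of a formal signed sum of elements of `W` under `f`. -/
def signedSum {W : Type*} (f : W → ℝ) (L : List (Bool × W)) : ℝ :=
  (L.map fun p => sgn p.1 * f p.2).sum

@[simp] lemma signedSum_nil {W : Type*} (f : W → ℝ) : signedSum f [] = 0 := rfl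

@[simp] lemma signedSum_cons {W : Type*} (f : W → ℝ) (p : Bool × W) (L : List (Bool × W)) :
    signedSum f (p :: L) = sgn p.1 * f p.2 + signedSum f L := by
  simp [signedSum]

@[simp] lemma signedSum_append {W : Type*} (f : W → ℝ) (L L' : List (Bool × W)) :
    signedSum f (L ++ L') = signedSum f L + signedSum f L' := by
  simp [signedSum]

@[simp] lemma sgn_true : sgn true = 1 := rfl
@[simp] lemma sgn_false : sgn false = -1 := rfl
@[simp] lemma sgn_not (s : Bool) : sgn (!s) = - sgn s := by cases s <;> simp
@[simp] lemma sgn_beq (s t : Bool) : sgn (s == t) = sgn s * sgn t := by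
  cases s <;> cases t <;> simp

/-- A coefficient `n` is realized by `|n|` repetitions with the sign of `n`. Signed lists are finite
data, so they can index a computable family of constraints, and they still reach all integer
coefficients. -/
lemma exists_signedSum_eq {W : Type*} (c : W →₀ ℤ) :
    ∃ L : List (Bool × W), ∀ f : W → ℝ, signedSum f L = c.sum fun w n => (n : ℝ) * f w := by
  classical
  induction c using Finsupp.induction_linear with
  | zero => exact ⟨[], fun f => by simp⟩
  | add c d hc hd =>
    obtain ⟨L, hL⟩ := hc
    obtain ⟨L', hL'⟩ := hd
    refine ⟨L ++ L', fun f => ?_⟩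
    rw [signedSum_append, hL, hL', Finsupp.sum_add_index'] <;> intros <;> simp [add_mul]
  | single w n =>
    refine ⟨List.replicate n.natAbs (decide (0 ≤ n), w), fun f => ?_⟩
    rw [Finsupp.sum_single_index (by simp)]
    simp only [signedSum, List.map_replicate, List.sum_replicate, nsmul_eq_mul, ← mul_assoc]
    congr 1
    by_cases h : 0 ≤ n
    · simp only [h, decide_true, sgn_true, mul_one, Nat.cast_natAbs, abs_of_nonneg]
    · simp only [h, decide_false, sgn_false, Nat.cast_natAbs, abs_of_neg (not_le.1 h)]
      push_cast; ring

lemma int_form_nonneg {W : Type*} {K : W → W → ℝ}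
    (h : ∀ L : List (Bool × W), 0 ≤ signedSum (fun u => signedSum (K u) L) L) (c : W →₀ ℤ) :
    0 ≤ c.sum fun u a => (a : ℝ) * c.sum fun v b => (b : ℝ) * K u v := by
  obtain ⟨L, hL⟩ := exists_signedSum_eq c
  simpa only [hL] using h L

lemma tendsto_floor_mul_div_natCast (x : ℝ) :
    Tendsto (fun t : ℕ => (⌊x * t⌋ / t : ℝ)) atTop (𝓝 x) := by
  have h0 : Tendsto (fun t : ℕ => x - 1 / (t : ℝ)) atTop (𝓝 x) := by
    simpa using tendsto_const_nhds.sub (tendsto_one_div_atTop_nhds_zero_nat (𝕜 := ℝ))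
  refine tendsto_of_tendsto_of_tendsto_of_le_of_le' h0 tendsto_const_nhds ?_ ?_
  · filter_upwards [eventually_gt_atTop 0] with t ht
    have ht' : (0 : ℝ) < t := by exact_mod_cast ht
    rw [le_div_iff₀ ht', sub_mul, one_div_mul_cancel ht'.ne']
    exact (Int.sub_one_lt_floor _).le
  · filter_upwards [eventually_gt_atTop 0] with t ht
    have ht' : (0 : ℝ) < t := by exact_mod_cast ht
    rw [div_le_iff₀ ht']
    exact Int.floor_le _

/-- Integer coefficients give rational ones by homogeneity of the quadratic form, and real ones by
continuity. -/
lemma real_form_nonneg {W : Type*} {K : W → W → ℝ}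
    (h : ∀ L : List (Bool × W), 0 ≤ signedSum (fun u => signedSum (K u) L) L)
    (s : Finset W) (c : W → ℝ) :
    0 ≤ ∑ u ∈ s, ∑ v ∈ s, c u * c v * K u v := by
  classical
  have key : ∀ t : ℕ, 0 < t →
      0 ≤ ∑ u ∈ s, ∑ v ∈ s, (⌊c u * t⌋ / t : ℝ) * (⌊c v * t⌋ / t : ℝ) * K u v := by
    intro t ht
    have h1 := int_form_nonneg h (Finsupp.onFinset s (fun u => if u ∈ s then ⌊c u * t⌋ else 0)
      (fun u hu => by by_contra h; simp [h] at hu))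
    rw [Finsupp.onFinset_sum _ (by simp)] at h1
    simp only [Finsupp.onFinset_sum, Int.cast_zero, zero_mul, implies_true] at h1
    have h2 : ∑ u ∈ s, ∑ v ∈ s, (⌊c u * t⌋ / t : ℝ) * (⌊c v * t⌋ / t : ℝ) * K u v
        = (1 / (t : ℝ) ^ 2) * ∑ u ∈ s, ((if u ∈ s then ⌊c u * t⌋ else 0 : ℤ) : ℝ) *
          ∑ v ∈ s, ((if v ∈ s then ⌊c v * t⌋ else 0 : ℤ) : ℝ) * K u v := by
      simp only [Finset.mul_sum]
      refine Finset.sum_congr rfl fun u hu => Finset.sum_congr rfl fun v hv => ?_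
      simp only [hu, hv, if_true]
      field_simp
    rw [h2]
    positivity
  have hlim : ∀ x : ℝ, Tendsto (fun t : ℕ => (⌊x * t⌋ / t : ℝ)) atTop (𝓝 x) := fun x =>
    tendsto_floor_mul_div_natCast x
  refine ge_of_tendsto (x := (atTop : Filter ℕ))
    (f := fun t : ℕ => ∑ u ∈ s, ∑ v ∈ s, (⌊c u * t⌋ / t : ℝ) * (⌊c v * t⌋ / t : ℝ) * K u v) ?_
    ((eventually_gt_atTop 0).mono key)
  exact tendsto_finsetSum _ fun u _ => tendsto_finsetSum _ fun v _ =>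
    ((hlim _).mul (hlim _)).mul_const _

/-- A symmetric real kernel which is nonnegative on signed sums is positive semidefinite over `ℂ`. -/
lemma posSemidef_of_signedSum {W : Type*} (K : W → W → ℝ) (hK : ∀ u v, K u v = K v u)
    (h : ∀ L : List (Bool × W), 0 ≤ signedSum (fun u => signedSum (K u) L) L) :
    (Matrix.of fun u v => (K u v : ℂ)).PosSemidef := by
  refine ⟨by ext u v; simp [Matrix.conjTranspose_apply, hK u v], fun x => ?_⟩
  have h1 := real_form_nonneg h x.support (fun u => (x u).re)
  have h2 := real_form_nonneg h x.support (fun u => (x u).im)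
  -- Symmetry of `K` cancels the cross terms, so the form at `x` is the sum of the real forms at its
  -- real and imaginary parts.
  have h3 : ∑ u ∈ x.support, ∑ v ∈ x.support, (x u).re * (x v).im * K u v
      = ∑ u ∈ x.support, ∑ v ∈ x.support, (x u).im * (x v).re * K u v := by
    rw [Finset.sum_comm]
    refine Finset.sum_congr rfl fun u _ => Finset.sum_congr rfl fun v _ => ?_
    rw [hK v u]; ring
  simp only [Finsupp.sum, Complex.le_def, Complex.zero_re, Complex.zero_im, Complex.re_sum,
    Complex.im_sum, Matrix.of_apply, Complex.mul_re, Complex.mul_im, Complex.ofReal_re,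
    Complex.ofReal_im, RCLike.star_def, Complex.conj_re, Complex.conj_im]
  constructor
  · refine (add_nonneg h1 h2).trans_eq ?_
    simp only [← Finset.sum_add_distrib]
    refine Finset.sum_congr rfl fun u _ => Finset.sum_congr rfl fun v _ => ?_
    ring
  · symm
    rw [← sub_eq_zero] at h3
    refine Eq.trans ?_ h3
    simp only [← Finset.sum_sub_distrib]
    refine Finset.sum_congr rfl fun u _ => Finset.sum_congr rfl fun v _ => ?_
    ring

/-! ### Gram vectors and operators determined on a total family -/

/-- The semi-inner product on finitely supported functions given by a positive semidefinite
matrix. -/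
abbrev kernelCore {W : Type*} {M : Matrix W W ℂ} (hM : M.PosSemidef) :
    PreInnerProductSpace.Core ℂ (W →₀ ℂ) where
  inner f g := f.sum fun u a => g.sum fun v b => star a * M u v * b
  conj_inner_symm f g := by
    rw [Finsupp.sum_comm]
    simp only [map_finsuppSum]
    refine Finsupp.sum_congr fun u _ => Finsupp.sum_congr fun v _ => ?_
    rw [← hM.isHermitian.apply]
    simp only [RCLike.star_def, map_mul, Complex.conj_conj]
    ring
  add_left _ _ _ := by
    rw [Finsupp.sum_add_index'] <;> simp [← Finsupp.sum_add, add_mul]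
  smul_left _ _ _ := by
    rw [Finsupp.sum_smul_index] <;> simp [Finsupp.mul_sum, ← mul_assoc]
  re_inner_nonneg f := (Complex.le_def.1 (hM.2 f)).1

/-- Every positive semidefinite matrix is the Gram matrix of a total family of vectors. -/
lemma exists_gram {W : Type} {M : Matrix W W ℂ} (hM : M.PosSemidef) :
    ∃ (H : Type) (_ : NormedAddCommGroup H) (_ : InnerProductSpace ℂ H) (_ : CompleteSpace H)
      (e : W → H), (∀ u v, inner ℂ (e u) (e v) = M u v) ∧
        DenseRange (Finsupp.linearCombination ℂ e) := by
  let core := kernelCore hM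
  let : SeminormedAddCommGroup (W →₀ ℂ) :=
    InnerProductSpace.Core.toSeminormedAddCommGroup (𝕜 := ℂ)
  let : InnerProductSpace ℂ (W →₀ ℂ) := .ofCore core
  let ι : (W →₀ ℂ) →L[ℂ] UniformSpace.Completion (W →₀ ℂ) := UniformSpace.Completion.toComplL
  refine ⟨UniformSpace.Completion (W →₀ ℂ), inferInstance, inferInstance, inferInstance,
    fun u => ι (Finsupp.single u 1), fun u v => ?_, ?_⟩
  · simp only [ι, UniformSpace.Completion.coe_toComplL, UniformSpace.Completion.inner_coe]
    change (Finsupp.single u (1 : ℂ)).sum (fun u a => (Finsupp.single v (1 : ℂ)).sum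
      fun v b => star a * M u v * b) = _
    simp
  · have : Finsupp.linearCombination ℂ (fun u => ι (Finsupp.single u 1)) = ι.toLinearMap := by
      ext u; simp
    rw [this]
    exact UniformSpace.Completion.denseRange_coe

section Total

variable {W H : Type*} [NormedAddCommGroup H] [InnerProductSpace ℂ H] {e : W → H}

lemma separableSpace_of_total [Countable W]
    (he : DenseRange (Finsupp.linearCombination ℂ e)) : TopologicalSpace.SeparableSpace H := by
  rw [← TopologicalSpace.isSeparable_univ_iff, ← he.closure_range]
  refine TopologicalSpace.IsSeparable.closure ?_
  have := (Set.countable_range e).isSeparable.span (R := ℂ)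
  rwa [← Finsupp.range_linearCombination] at this

lemma inner_linearCombination (e e' : W → H) (c d : W →₀ ℂ) :
    inner ℂ (Finsupp.linearCombination ℂ e c) (Finsupp.linearCombination ℂ e' d) =
      c.sum fun u a => d.sum fun v b => star a * inner ℂ (e u) (e' v) * b := by
  simp only [Finsupp.linearCombination_apply, Finsupp.sum, sum_inner, inner_sum,
    inner_smul_left, inner_smul_right, Finset.mul_sum]
  rw [Finset.sum_comm]
  refine Finset.sum_congr rfl fun u _ => Finset.sum_congr rfl fun v _ => ?_
  simp only [RCLike.star_def]; ring

/-- A self-map of a total family which does not increase norms extends to a bounded operator. -/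
lemma exists_operator [CompleteSpace H] (he : DenseRange (Finsupp.linearCombination ℂ e))
    (τ : W → W) (hτ : (Matrix.of fun u v =>
      inner ℂ (e u) (e v) - inner ℂ (e (τ u)) (e (τ v))).PosSemidef) :
    ∃ T : H →L[ℂ] H, ∀ u, T (e u) = e (τ u) := by
  -- The hypothesis says exactly that the form of the shifted family is dominated by that of `e`, so
  -- `C = 1` works. This bound also makes the extension well defined where the vectors `e u` are
  -- linearly dependent.
  have hbound : ∃ C : ℝ, ∀ c, ‖Finsupp.linearCombination ℂ (e ∘ τ) c‖ ≤
      C * ‖Finsupp.linearCombination ℂ e c‖ := by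
    refine ⟨1, fun c => ?_⟩
    rw [one_mul, ← sq_le_sq₀ (norm_nonneg _) (norm_nonneg _), ← sub_nonneg]
    have h := (Complex.le_def.1 (hτ.2 c)).1
    simp only [Matrix.of_apply, mul_sub, sub_mul, Finsupp.sum_sub] at h
    rw [← inner_linearCombination, Complex.zero_re] at h
    have h' := inner_linearCombination (e ∘ τ) (e ∘ τ) c c
    simp only [Function.comp_apply] at h'
    rw [← h', inner_self_eq_norm_sq_to_K, inner_self_eq_norm_sq_to_K] at h
    exact_mod_cast h
  refine ⟨(Finsupp.linearCombination ℂ (e ∘ τ)).extendOfNorm (Finsupp.linearCombination ℂ e),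
    fun u => ?_⟩
  simpa using LinearMap.extendOfNorm_eq he hbound (Finsupp.single u 1)

lemma isPositive_of_total (he : DenseRange (Finsupp.linearCombination ℂ e)) (T : H →L[ℂ] H)
    (hT : (Matrix.of fun u v => inner ℂ (T (e u)) (e v)).PosSemidef) : T.IsPositive := by
  have key : ∀ x, 0 ≤ inner ℂ (T x) x := by
    intro x
    refine he.induction_on (p := fun x => 0 ≤ inner ℂ (T x) x) x ?_ fun c => ?_
    · exact isClosed_le continuous_const (by fun_prop)
    · rw [← ContinuousLinearMap.coe_coe, LinearMap.map_finsupp_linearCombination,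
        inner_linearCombination]
      exact hT.2 c
  rw [ContinuousLinearMap.isPositive_iff_complex]
  intro x
  have := Complex.le_def.1 (key x)
  exact ⟨Complex.ext (by simp) (by simpa using this.2), this.1⟩

lemma eq_of_total (he : DenseRange (Finsupp.linearCombination ℂ e)) {S T : H →L[ℂ] H}
    (h : ∀ u, S (e u) = T (e u)) : S = T := by
  refine ContinuousLinearMap.ext fun x => ?_
  refine he.induction_on (p := fun x => S x = T x) x
    (isClosed_eq S.continuous T.continuous) fun c => ?_
  simp only [Finsupp.linearCombination_apply, Finsupp.sum, map_sum, map_smul, h]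

lemma eq_of_inner_total (he : DenseRange (Finsupp.linearCombination ℂ e)) {x y : H}
    (h : ∀ u, inner ℂ (e u) x = inner ℂ (e u) y) : x = y := by
  refine he.eq_of_inner_right ℂ ?_
  rintro c
  simp only [Finsupp.linearCombination_apply, Finsupp.sum_inner, inner_smul_left, h]

end Total

end NonlocalGames
end

/-! ### Words, linear constraints, and the moments of a strategy -/

noncomputable section

namespace NonlocalGames

open scoped ComplexOrder ComplexConjugate

/-- A letter `(s, x, a)` names the operator of the answer `a` to the question `x`, for the first
player if `s` is true and for the second player otherwise. -/
abbrev Letter : Type := Bool × ℕ × ℕ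

/-- Words in the POVM elements of both players. -/
abbrev Word : Type := List Letter

/-- Formal signed sums of words. -/
abbrev SignedSum : Type := List (Bool × Word)

/-- The signed sum `L* x L` for a signed sum `L` and a word `x`. -/
def conjugate (x : Word) (L : SignedSum) : SignedSum :=
  L.flatMap fun p => L.map fun q => (p.1 == q.1, p.2.reverse ++ (x ++ q.2))

/-- The negative of a signed sum. -/
def negate (L : SignedSum) : SignedSum := L.map fun p => (!p.1, p.2)

/-- The answers `a`, `b` to the questions `x`, `y` lose, and the questions are asked. -/
def losing (d : GameDesc) (x y a b : ℕ) : Bool :=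
  !(((d.2.2.1.getD x []).getD y (0, 1)).1 == 0) &&
    !((((d.2.2.2.getD x []).getD y []).getD a []).getD b true)

/-- Indices for the linear constraints on the moments of a strategy: positivity, positivity of
letters, contractivity of letters, symmetry, commutation, completeness of the POVMs, and
perfection. -/
abbrev ConstraintIndex : Type :=
  SignedSum ⊕ (Letter × SignedSum) ⊕ (Letter × SignedSum) ⊕ (Bool × Word) ⊕
    (Bool × (ℕ × ℕ) × (ℕ × ℕ) × Word × Word) ⊕ (Bool × Bool × ℕ × Word × Word) ⊕
      ((ℕ × ℕ) × (ℕ × ℕ))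

instance : Primcodable ((Bool × (ℕ × ℕ) × (ℕ × ℕ) × Word × Word) ⊕
    (Bool × Bool × ℕ × Word × Word) ⊕ ((ℕ × ℕ) × (ℕ × ℕ))) := inferInstance

instance : Primcodable ConstraintIndex := Primcodable.sum

/-- The signed sums of words which are nonnegative on the moments of a perfect strategy for the
game described by `d`. -/
def constraint (d : GameDesc) : ConstraintIndex → SignedSum
  | .inl L => conjugate [] L
  | .inr (.inl (g, L)) => conjugate [g] L
  | .inr (.inr (.inl (g, L))) => conjugate [] L ++ negate (conjugate [g, g] L)
  | .inr (.inr (.inr (.inl (s, w)))) => [(s, w), (!s, w.reverse)]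
  | .inr (.inr (.inr (.inr (.inl (s, p, q, u, v))))) =>
      [(s, u ++ (true, p) :: (false, q) :: v), (!s, u ++ (false, q) :: (true, p) :: v)]
  | .inr (.inr (.inr (.inr (.inr (.inl (s, t, x, u, v)))))) =>
      if x < d.1 then
        (!s, u ++ v) :: (List.range d.2.1).map fun a => (s, u ++ (t, x, a) :: v)
      else []
  | .inr (.inr (.inr (.inr (.inr (.inr (p, q)))))) =>
      if losing d p.1 q.1 p.2 q.2 then [(false, [(true, p), (false, q)])] else []

/-- Normalized moments which satisfy all constraints up to `ε`. -/
structure IsMoment (d : GameDesc) (ε : ℝ) (m : Word → ℝ) : Prop where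
  nil : m [] = 1
  abs_le : ∀ w, |m w| ≤ 1
  nonneg : ∀ i, -ε ≤ signedSum m (constraint d i)

lemma signedSum_negate (m : Word → ℝ) (L : SignedSum) :
    signedSum m (negate L) = - signedSum m L := by
  induction L with
  | nil => simp [negate]
  | cons p L ih =>
    simp only [negate, List.map_cons, signedSum_cons, sgn_not] at ih ⊢
    rw [ih]; ring

lemma signedSum_conjugate (m : Word → ℝ) (x : Word) (L : SignedSum) :
    signedSum m (conjugate x L) =
      signedSum (fun u => signedSum (fun v => m (u.reverse ++ (x ++ v))) L) L := by
  have key : ∀ L' : SignedSum, signedSum m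
      (L'.flatMap fun p => L.map fun q => (p.1 == q.1, p.2.reverse ++ (x ++ q.2))) =
      signedSum (fun u => signedSum (fun v => m (u.reverse ++ (x ++ v))) L) L' := by
    intro L'
    induction L' with
    | nil => simp
    | cons p L' ih =>
      rw [List.flatMap_cons, signedSum_append, ih, signedSum_cons]
      congr 1
      simp only [signedSum, List.map_map, Function.comp_def, sgn_beq, mul_assoc,
        List.sum_map_mul_left]
  exact key L

namespace Strategy

variable {G : Game} {H : Type} [NormedAddCommGroup H] [InnerProductSpace ℂ H] (S : Strategy G H)

/-- The operator named by a letter; zero if question or answer are out of range. -/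
def op (g : Letter) : H →L[ℂ] H :=
  if h : g.2.1 < G.numQ ∧ g.2.2 < G.numA then
    if g.1 then S.A ⟨g.2.1, h.1⟩ ⟨g.2.2, h.2⟩ else S.B ⟨g.2.1, h.1⟩ ⟨g.2.2, h.2⟩
  else 0

/-- The operator of a word. -/
def wordOp (w : Word) : H →L[ℂ] H := (w.map S.op).prod

/-- The moments of a strategy. -/
def moment (w : Word) : ℝ := (inner ℂ S.ψ (S.wordOp w S.ψ)).re

lemma op_true (x : Fin G.numQ) (a : Fin G.numA) : S.op (true, x, a) = S.A x a := by
  simp [op]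

lemma op_false (x : Fin G.numQ) (a : Fin G.numA) : S.op (false, x, a) = S.B x a := by
  simp [op]

lemma op_isPositive (g : Letter) : (S.op g).IsPositive := by
  unfold op
  split_ifs
  · exact S.A_pos _ _
  · exact S.B_pos _ _
  · exact ContinuousLinearMap.isPositive_zero

lemma op_commute (p q : ℕ × ℕ) : Commute (S.op (true, p)) (S.op (false, q)) := by
  by_cases hp : p.1 < G.numQ ∧ p.2 < G.numA
  · by_cases hq : q.1 < G.numQ ∧ q.2 < G.numA
    · simpa [op, hp, hq] using S.comm _ _ _ _
    · simp [op, hq]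
  · simp [op, hp]

lemma sum_op (t : Bool) {x : ℕ} (hx : x < G.numQ) :
    ((List.range G.numA).map fun a => S.op (t, x, a)).sum = 1 := by
  change ∑ a ∈ Finset.range G.numA, S.op (t, x, a) = 1
  rw [Finset.sum_range]
  cases t
  · exact (Finset.sum_congr rfl fun b _ => S.op_false ⟨x, hx⟩ b).trans (S.B_sum _)
  · exact (Finset.sum_congr rfl fun a _ => S.op_true ⟨x, hx⟩ a).trans (S.A_sum _)

@[simp] lemma wordOp_nil : S.wordOp [] = 1 := rfl

@[simp] lemma wordOp_cons (g : Letter) (w : Word) : S.wordOp (g :: w) = S.op g * S.wordOp w := by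
  simp [wordOp]

@[simp] lemma wordOp_append (u v : Word) : S.wordOp (u ++ v) = S.wordOp u * S.wordOp v := by
  simp [wordOp]

/-- The vector obtained by applying a signed sum of words. -/
def vec (L : SignedSum) : H := (L.map fun p => (sgn p.1 : ℂ) • S.wordOp p.2 S.ψ).sum

lemma re_inner_vec (y : H) (L : SignedSum) :
    (inner ℂ y (S.vec L)).re = signedSum (fun v => (inner ℂ y (S.wordOp v S.ψ)).re) L := by
  induction L with
  | nil => simp [vec]
  | cons p L ih =>
    simp only [vec, List.map_cons, List.sum_cons, inner_add_right, Complex.add_re,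
      signedSum_cons, inner_smul_right, Complex.re_ofReal_mul] at ih ⊢
    rw [ih]

/-- The probability of the answers `a`, `b` to the questions `x`, `y`. -/
def prob (x y : Fin G.numQ) (a b : Fin G.numA) : ℝ :=
  (inner ℂ S.ψ ((S.A x a * S.B y b) S.ψ)).re

lemma moment_pair (x y : Fin G.numQ) (a b : Fin G.numA) :
    S.moment [(true, x, a), (false, y, b)] = S.prob x y a b := by
  simp [moment, prob, op_true, op_false]

lemma sum_prob (x y : Fin G.numQ) : ∑ a, ∑ b, S.prob x y a b = 1 := by
  have h : ∑ a, ∑ b, S.A x a * S.B y b = 1 := by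
    simp only [← Finset.mul_sum, S.B_sum, mul_one, S.A_sum]
  simp only [prob, ← Complex.re_sum, ← inner_sum, ← sum_apply, h]
  simp [inner_self_eq_norm_sq_to_K, S.norm_ψ]

/-- The outcome probabilities have total weight one, so the deficit is the weight of the losing
outcomes. -/
lemma one_sub_value : 1 - S.value =
    ∑ x, ∑ y, ∑ a, ∑ b, (G.μ x y : ℝ) * S.prob x y a b * (if G.D x y a b then 0 else 1) := by
  have h : (1 : ℝ) = ∑ x, ∑ y, ∑ a, ∑ b, (G.μ x y : ℝ) * S.prob x y a b := by
    simp only [← Finset.mul_sum, sum_prob, mul_one]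
    exact_mod_cast G.μ_sum.symm
  refine (congrArg (· - S.value) h).trans ?_
  simp only [value, ← Finset.sum_sub_distrib]
  refine Finset.sum_congr rfl fun x _ => Finset.sum_congr rfl fun y _ =>
    Finset.sum_congr rfl fun a _ => Finset.sum_congr rfl fun b _ => ?_
  rw [prob]
  split_ifs <;> ring

variable [CompleteSpace H]

lemma star_op (g : Letter) : star (S.op g) = S.op g := (S.op_isPositive g).isSelfAdjoint

lemma star_wordOp (w : Word) : star (S.wordOp w) = S.wordOp w.reverse := by
  induction w with
  | nil => simp
  | cons g w ih => simp [star_op, ih]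

lemma inner_wordOp_left (w : Word) (x y : H) :
    inner ℂ (S.wordOp w x) y = inner ℂ x (S.wordOp w.reverse y) := by
  rw [← star_wordOp, ContinuousLinearMap.star_eq_adjoint,
    ContinuousLinearMap.adjoint_inner_right]

/-- Letters are self-adjoint, so reversing a word takes the adjoint. The constraints on conjugates
thereby become statements about the quadratic form of an operator at the vector `S.vec L`. -/
lemma signedSum_moment_conjugate (x : Word) (L : SignedSum) :
    signedSum S.moment (conjugate x L) = (inner ℂ (S.vec L) (S.wordOp x (S.vec L))).re := by
  have h1 : ∀ u : Word, signedSum (fun v => S.moment (u.reverse ++ (x ++ v))) L =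
      (inner ℂ (S.wordOp x (S.vec L)) (S.wordOp u S.ψ)).re := by
    intro u
    have h2 : S.wordOp x (S.vec L) = S.wordOp x.reverse.reverse (S.vec L) := by simp
    rw [← inner_conj_symm, Complex.conj_re, h2, ← inner_wordOp_left, re_inner_vec]
    simp only [inner_wordOp_left, moment, List.reverse_reverse, wordOp_append,
      mul_apply_eq_comp]
  simp only [signedSum_conjugate, h1]
  rw [← re_inner_vec, ← inner_conj_symm, Complex.conj_re]

/-- A POVM element lies between `0` and the sum of its POVM, which is `1`. -/
lemma norm_op_le (g : Letter) : ‖S.op g‖ ≤ 1 := by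
  have key : ∀ {n : ℕ} (f : Fin n → (H →L[ℂ] H)), (∀ a, (f a).IsPositive) → ∑ a, f a = 1 →
      ∀ a, ‖f a‖ ≤ 1 := by
    intro n f hf hsum a
    have h0 : ∀ a, 0 ≤ f a := fun a => (ContinuousLinearMap.nonneg_iff_isPositive _).2 (hf a)
    rw [CStarAlgebra.norm_le_one_iff_of_nonneg _ (h0 a), ← hsum]
    exact Finset.single_le_sum (fun b _ => h0 b) (Finset.mem_univ a)
  unfold op
  split_ifs
  · exact key _ (S.A_pos _) (S.A_sum _) _
  · exact key _ (S.B_pos _) (S.B_sum _) _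
  · simp

lemma norm_wordOp_le (w : Word) : ‖S.wordOp w‖ ≤ 1 := by
  induction w with
  | nil => exact ContinuousLinearMap.norm_id_le
  | cons g w ih =>
    rw [wordOp_cons]
    exact (norm_mul_le _ _).trans (mul_le_one₀ (S.norm_op_le g) (norm_nonneg _) ih)

lemma abs_moment_le (w : Word) : |S.moment w| ≤ 1 := by
  refine (Complex.abs_re_le_norm _).trans ((norm_inner_le_norm _ _).trans ?_)
  have := (S.wordOp w).le_opNorm S.ψ
  rw [S.norm_ψ, mul_one] at this
  rw [S.norm_ψ, one_mul]
  exact this.trans (S.norm_wordOp_le w)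

lemma prob_nonneg (x y : Fin G.numQ) (a b : Fin G.numA) : 0 ≤ S.prob x y a b := by
  have h : 0 ≤ S.A x a * S.B y b := Commute.mul_nonneg
    ((ContinuousLinearMap.nonneg_iff_isPositive _).2 (S.A_pos x a))
    ((ContinuousLinearMap.nonneg_iff_isPositive _).2 (S.B_pos y b)) (S.comm x y a b)
  exact ((ContinuousLinearMap.nonneg_iff_isPositive _).1 h).re_inner_nonneg_right S.ψ

lemma loss_nonneg (x y : Fin G.numQ) (a b : Fin G.numA) :
    0 ≤ (G.μ x y : ℝ) * S.prob x y a b * (if G.D x y a b then 0 else 1) :=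
  mul_nonneg (mul_nonneg (by exact_mod_cast G.μ_nonneg x y) (S.prob_nonneg x y a b))
    (by split_ifs <;> norm_num)

lemma value_le_one : S.value ≤ 1 := by
  rw [← sub_nonneg, one_sub_value]
  exact Finset.sum_nonneg fun x _ => Finset.sum_nonneg fun y _ => Finset.sum_nonneg fun a _ =>
    Finset.sum_nonneg fun b _ => S.loss_nonneg x y a b

/-- All terms of the total loss are nonnegative, so it bounds each of them. -/
lemma mul_prob_le {x y : Fin G.numQ} {a b : Fin G.numA} (h : G.D x y a b = false) :
    (G.μ x y : ℝ) * S.prob x y a b ≤ 1 - S.value := by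
  rw [one_sub_value]
  have h1 := fun b => S.loss_nonneg x y a b
  have h2 := fun a => Finset.sum_nonneg fun b (_ : b ∈ Finset.univ) => S.loss_nonneg x y a b
  have h3 := fun y => Finset.sum_nonneg fun a (_ : a ∈ Finset.univ) =>
    Finset.sum_nonneg fun b (_ : b ∈ Finset.univ) => S.loss_nonneg x y a b
  have h4 := fun x => Finset.sum_nonneg fun y (_ : y ∈ Finset.univ) =>
    Finset.sum_nonneg fun a (_ : a ∈ Finset.univ) =>
    Finset.sum_nonneg fun b (_ : b ∈ Finset.univ) => S.loss_nonneg x y a b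
  refine le_trans ?_ (Finset.single_le_sum (fun x _ => h4 x) (Finset.mem_univ x))
  refine le_trans ?_ (Finset.single_le_sum (fun y _ => h3 y) (Finset.mem_univ y))
  refine le_trans ?_ (Finset.single_le_sum (fun a _ => h2 a) (Finset.mem_univ a))
  refine le_trans ?_ (Finset.single_le_sum (fun b _ => h1 b) (Finset.mem_univ b))
  simp [h]

end Strategy

end NonlocalGames
end

/-! ### From near-perfect strategies to moments, and from exact moments to a perfect strategy -/

noncomputable section

namespace NonlocalGames

open scoped ComplexOrder ComplexConjugate
open Filter Topology

lemma losing_desc (G : Game) (x y : Fin G.numQ) (a b : Fin G.numA) :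
    losing G.desc x y a b = true ↔ G.μ x y ≠ 0 ∧ G.D x y a b = false := by
  have h : (G.μ x y).num.toNat = 0 ↔ G.μ x y = 0 := by
    rw [Int.toNat_eq_zero, ← Rat.num_eq_zero]
    exact ⟨fun h => le_antisymm h (Rat.num_nonneg.2 (G.μ_nonneg x y)), fun h => h.le⟩
  simp [losing, Game.desc, h]

/-- The defaults in `losing` are chosen for this: a missing entry of `μ` reads as probability zero
and a missing entry of `D` as a win, so nothing outside the tables loses. -/
lemma lt_of_losing_desc {G : Game} {x y a b : ℕ} (h : losing G.desc x y a b = true) :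
    x < G.numQ ∧ y < G.numQ ∧ a < G.numA ∧ b < G.numA := by
  have hx : x < G.numQ := by
    by_contra hx
    simp [losing, Game.desc, hx] at h
  have hy : y < G.numQ := by
    by_contra hy
    simp [losing, Game.desc, hx, hy] at h
  have ha : a < G.numA := by
    by_contra ha
    simp [losing, Game.desc, hx, hy, ha] at h
  have hb : b < G.numA := by
    by_contra hb
    simp [losing, Game.desc, hx, hy, ha, hb] at h
  exact ⟨hx, hy, ha, hb⟩

lemma signedSum_povm (m : Word → ℝ) (s t : Bool) (x n : ℕ) (u v : Word) :
    signedSum m ((!s, u ++ v) :: (List.range n).map fun a => (s, u ++ (t, x, a) :: v)) =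
      sgn s * (∑ a : Fin n, m (u ++ (t, x, (a : ℕ)) :: v) - m (u ++ v)) := by
  rw [signedSum_cons, ← Finset.sum_range fun a => m (u ++ (t, x, a) :: v)]
  have : signedSum m ((List.range n).map fun a => (s, u ++ (t, x, a) :: v)) =
      sgn s * ∑ a ∈ Finset.range n, m (u ++ (t, x, a) :: v) := by
    rw [Finset.mul_sum, signedSum, List.map_map]
    rfl
  rw [this, sgn_not]
  ring

namespace Strategy

variable {G : Game} {H : Type} [NormedAddCommGroup H] [InnerProductSpace ℂ H]
  (S : Strategy G H)

lemma sum_moment (t : Bool) {x : ℕ} (hx : x < G.numQ) (u v : Word) :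
    ∑ a : Fin G.numA, S.moment (u ++ (t, x, (a : ℕ)) :: v) = S.moment (u ++ v) := by
  have h : ∑ a : Fin G.numA, S.op (t, x, a) = 1 := by
    rw [← S.sum_op t hx, ← Finset.sum_range fun a => S.op (t, x, a)]
    rfl
  have h' : S.wordOp (u ++ v) = ∑ a : Fin G.numA, S.wordOp (u ++ (t, x, (a : ℕ)) :: v) := by
    simp only [wordOp_append, wordOp_cons, ← Finset.mul_sum, ← Finset.sum_mul, h, one_mul]
  simp only [moment, h', sum_apply, inner_sum, Complex.re_sum]

variable [CompleteSpace H]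

lemma moment_reverse (w : Word) : S.moment w.reverse = S.moment w := by
  rw [moment, ← inner_wordOp_left, ← inner_conj_symm, Complex.conj_re, moment]

lemma isMoment {ε : ℝ} (hε : 0 ≤ ε)
    (hS : ∀ x y, G.μ x y ≠ 0 → 1 - S.value ≤ ε * G.μ x y) : IsMoment G.desc ε S.moment where
  nil := by simp [moment, inner_self_eq_norm_sq_to_K, S.norm_ψ]
  abs_le := S.abs_moment_le
  nonneg i := by
    -- Every strategy satisfies the algebraic and positivity constraints exactly; the error `ε` is
    -- spent only on the losing probabilities.
    suffices h : 0 ≤ signedSum S.moment (constraint G.desc i) ∨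
        -ε ≤ signedSum S.moment (constraint G.desc i) from
      h.elim (fun h => (neg_nonpos.2 hε).trans h) id
    rcases i with L | ⟨g, L⟩ | ⟨g, L⟩ | ⟨s, w⟩ | ⟨s, p, q, u, v⟩ | ⟨s, t, x, u, v⟩ |
      ⟨⟨x, a⟩, ⟨y, b⟩⟩ <;> simp only [constraint]
    · left
      rw [signedSum_moment_conjugate]
      exact inner_self_nonneg (𝕜 := ℂ)
    · left
      rw [signedSum_moment_conjugate]
      simpa using (S.op_isPositive g).re_inner_nonneg_right (S.vec L)
    · left
      rw [signedSum_append, signedSum_negate, signedSum_moment_conjugate,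
        signedSum_moment_conjugate, ← sub_eq_add_neg, sub_nonneg]
      have h1 : inner ℂ (S.vec L) (S.wordOp [g, g] (S.vec L)) =
          inner ℂ (S.op g (S.vec L)) (S.op g (S.vec L)) := by
        have := S.inner_wordOp_left [g] (S.vec L) (S.op g (S.vec L))
        simpa using this.symm
      rw [h1]
      simp only [wordOp_nil, one_apply_eq_self, inner_self_eq_norm_sq_to_K]
      norm_cast
      have := (S.op g).le_of_opNorm_le (S.norm_op_le g) (S.vec L)
      rw [one_mul] at this
      exact pow_le_pow_left₀ (norm_nonneg _) this 2
    · left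
      simp [moment_reverse]
    · left
      have : S.moment (u ++ (true, p) :: (false, q) :: v) =
          S.moment (u ++ (false, q) :: (true, p) :: v) := by
        have h : S.op (true, p) * (S.op (false, q) * S.wordOp v) =
            S.op (false, q) * (S.op (true, p) * S.wordOp v) := by
          rw [← mul_assoc, (S.op_commute p q).eq, mul_assoc]
        simp only [moment, wordOp_append, wordOp_cons, h]
      simp [this]
    · left
      split_ifs with hx
      · rw [signedSum_povm]
        exact ((congrArg (sgn s * ·) (sub_eq_zero.2 (S.sum_moment t hx u v))).trans
          (mul_zero _)).ge
      · simp
    · right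
      split_ifs with h
      · obtain ⟨hx, hy, ha, hb⟩ := lt_of_losing_desc h
        have h' := (losing_desc G ⟨x, hx⟩ ⟨y, hy⟩ ⟨a, ha⟩ ⟨b, hb⟩).1 h
        have hp := S.moment_pair ⟨x, hx⟩ ⟨y, hy⟩ ⟨a, ha⟩ ⟨b, hb⟩
        have h1 := (S.mul_prob_le h'.2).trans (hS _ _ h'.1)
        have hμ : (0 : ℝ) < G.μ ⟨x, hx⟩ ⟨y, hy⟩ := by
          exact_mod_cast lt_of_le_of_ne (G.μ_nonneg _ _) (Ne.symm h'.1)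
        rw [mul_comm] at h1
        have h2 := le_of_mul_le_mul_right h1 hμ
        simp only [signedSum_cons, signedSum_nil, sgn_false]
        rw [hp]
        linarith
      · simpa using hε

end Strategy

lemma exists_isMoment_of_coValue {G : Game} (hG : G.coValue = 1) {ε : ℝ} (hε : 0 < ε) :
    ∃ m, IsMoment G.desc ε m := by
  -- A deficit `δ` bounds a losing probability only after division by `μ x y`; there are finitely
  -- many question pairs, so one `δ` serves all.
  obtain ⟨δ, hδ, hδμ⟩ : ∃ δ : ℝ, 0 < δ ∧ ∀ x y, G.μ x y ≠ 0 → δ ≤ ε * G.μ x y := by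
    have h : ∀ᶠ δ in 𝓝[>] (0 : ℝ), ∀ x y, G.μ x y ≠ 0 → δ ≤ ε * G.μ x y := by
      refine eventually_all.2 fun x => eventually_all.2 fun y => ?_
      by_cases hxy : G.μ x y = 0
      · exact Eventually.of_forall fun _ h => absurd hxy h
      · have hμ : (0 : ℝ) < G.μ x y := by
          exact_mod_cast lt_of_le_of_ne (G.μ_nonneg _ _) (Ne.symm hxy)
        filter_upwards [Ioo_mem_nhdsGT (mul_pos hε hμ)] with δ hδ _ using hδ.2.le
    exact (eventually_mem_nhdsWithin.and h).exists
  have hlt : 1 - δ < G.coValue := by rw [hG]; linarith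
  -- Strategies exist because the supremum of the empty set is `0` by convention, not `1`.
  obtain ⟨v, ⟨H, i1, i2, i3, -, S, rfl⟩, hv⟩ := exists_lt_of_lt_csSup (by
    by_contra h
    rw [Set.not_nonempty_iff_eq_empty] at h
    rw [Game.coValue, h, Real.sSup_empty] at hG
    exact zero_ne_one hG) hlt
  exact ⟨S.moment, S.isMoment hε.le fun x y hxy => by linarith [hδμ x y hxy]⟩

lemma coValue_eq_one_of_strategy {G : Game} {H : Type} [i1 : NormedAddCommGroup H]
    [i2 : InnerProductSpace ℂ H] [i3 : CompleteSpace H] [i4 : TopologicalSpace.SeparableSpace H]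
    (S : Strategy G H) (hS : S.value = 1) : G.coValue = 1 := by
  refine IsGreatest.csSup_eq ⟨⟨H, i1, i2, i3, i4, S, hS.symm⟩, ?_⟩
  rintro v ⟨K, _, _, _, _, T, rfl⟩
  exact T.value_le_one

namespace IsMoment

variable {d : GameDesc} {m : Word → ℝ} (hm : IsMoment d 0 m)
include hm

lemma constraint_nonneg (i : ConstraintIndex) : 0 ≤ signedSum m (constraint d i) := by
  simpa using hm.nonneg i

/-- The constraint index carries a sign, so an equality is imposed as two opposite inequalities; the
same holds in `swap` and `sum_povm`. -/
lemma reverse (w : Word) : m w.reverse = m w := by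
  have h1 := hm.constraint_nonneg (.inr (.inr (.inr (.inl (true, w)))))
  have h2 := hm.constraint_nonneg (.inr (.inr (.inr (.inl (false, w)))))
  simp [constraint] at h1 h2
  linarith

lemma swap (p q : ℕ × ℕ) (u v : Word) :
    m (u ++ (true, p) :: (false, q) :: v) = m (u ++ (false, q) :: (true, p) :: v) := by
  have h1 := hm.constraint_nonneg (.inr (.inr (.inr (.inr (.inl (true, p, q, u, v))))))
  have h2 := hm.constraint_nonneg (.inr (.inr (.inr (.inr (.inl (false, p, q, u, v))))))
  simp [constraint] at h1 h2
  linarith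

lemma sum_povm (t : Bool) {x : ℕ} (hx : x < d.1) (u v : Word) :
    ∑ a : Fin d.2.1, m (u ++ (t, x, (a : ℕ)) :: v) = m (u ++ v) := by
  have h1 := hm.constraint_nonneg (.inr (.inr (.inr (.inr (.inr (.inl (true, t, x, u, v)))))))
  have h2 := hm.constraint_nonneg (.inr (.inr (.inr (.inr (.inr (.inl (false, t, x, u, v)))))))
  simp only [constraint, hx, if_true, signedSum_povm, sgn_true, sgn_false] at h1 h2
  linarith

lemma posSemidef : (Matrix.of fun u v : Word => (m (u.reverse ++ v) : ℂ)).PosSemidef := by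
  refine posSemidef_of_signedSum (fun u v => m (u.reverse ++ v)) (fun u v => ?_) fun L => ?_
  · rw [← hm.reverse]; simp
  · simpa [constraint, signedSum_conjugate] using hm.constraint_nonneg (.inl L)

lemma posSemidef_letter (g : Letter) :
    (Matrix.of fun u v : Word => (m (u.reverse ++ (g :: v)) : ℂ)).PosSemidef := by
  refine posSemidef_of_signedSum (fun u v => m (u.reverse ++ (g :: v))) (fun u v => ?_) fun L => ?_
  · rw [← hm.reverse]; simp
  · simpa [constraint, signedSum_conjugate] using hm.constraint_nonneg (.inr (.inl (g, L)))

/-- Prepending `g` to both words changes the Gram entry into the subtracted term, so this is the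
hypothesis that `exists_operator` needs for left concatenation by `g`. -/
lemma posSemidef_contraction (g : Letter) : (Matrix.of fun u v : Word =>
    ((m (u.reverse ++ v) - m (u.reverse ++ (g :: g :: v)) : ℝ) : ℂ)).PosSemidef := by
  refine posSemidef_of_signedSum (fun u v => m (u.reverse ++ v) - m (u.reverse ++ (g :: g :: v)))
    (fun u v => ?_) fun L => ?_
  · congr 1 <;> rw [← hm.reverse] <;> simp
  · have h := hm.constraint_nonneg (.inr (.inr (.inl (g, L))))
    have hsub : ∀ (f f' : Word → ℝ) (L : SignedSum),
        signedSum (fun u => f u - f' u) L = signedSum f L - signedSum f' L := by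
      intro f f' L
      induction L with
      | nil => simp
      | cons p L ih => simp only [signedSum_cons, ih]; ring
    simp only [hsub]
    simpa [constraint, signedSum_conjugate, signedSum_negate, ← sub_eq_add_neg] using h

end IsMoment

/-- GNS: words become vectors `e u` with Gram matrix `m (u.reverse ++ v)`, letters act by left
concatenation, and the empty word is the state. Operator identities are checked on matrix entries
between words, where they are identities of `m`. Words are countable, so the space is separable. -/
lemma coValue_eq_one_of_isMoment {G : Game} {m : Word → ℝ} (hm : IsMoment G.desc 0 m) :
    G.coValue = 1 := by
  obtain ⟨H, _, _, _, e, hinner, he⟩ := exists_gram hm.posSemidef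
  simp only [Matrix.of_apply] at hinner
  have : TopologicalSpace.SeparableSpace H := separableSpace_of_total he
  have hT : ∀ g : Letter, ∃ T : H →L[ℂ] H, ∀ u, T (e u) = e (g :: u) := fun g => by
    refine exists_operator he (g :: ·) ?_
    convert hm.posSemidef_contraction g using 4 with u v
    simp [hinner]
  choose T hT using hT
  have hpos : ∀ g, (T g).IsPositive := fun g => by
    refine isPositive_of_total he _ ?_
    convert hm.posSemidef_letter g using 4 with u v
    simp [hT, hinner]
  have hsum : ∀ (t : Bool) (x : Fin G.numQ), ∑ a : Fin G.numA, T (t, x, a) = 1 := by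
    intro t x
    refine eq_of_total he fun v => eq_of_inner_total he fun u => ?_
    simp only [sum_apply, inner_sum, hT, hinner, one_apply_eq_self]
    exact_mod_cast hm.sum_povm t x.2 u.reverse v
  let S : Strategy G H :=
    { ψ := e []
      norm_ψ := by
        have h : ‖e []‖ ^ 2 = 1 := by
          rw [← inner_self_eq_norm_sq (𝕜 := ℂ), hinner]
          simp [hm.nil]
        exact (pow_eq_one_iff_of_nonneg (norm_nonneg _) two_ne_zero).1 h
      A := fun x a => T (true, x, a)
      B := fun y b => T (false, y, b)
      A_pos := fun _ _ => hpos _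
      B_pos := fun _ _ => hpos _
      A_sum := hsum true
      B_sum := hsum false
      comm := fun x y a b => by
        refine eq_of_total he fun v => eq_of_inner_total he fun u => ?_
        simp only [mul_apply_eq_comp, hT, hinner]
        exact_mod_cast hm.swap _ _ _ _ }
  refine coValue_eq_one_of_strategy S ?_
  have hprob : ∀ x y a b, S.prob x y a b = m [(true, x, a), (false, y, b)] := by
    intro x y a b
    simp [Strategy.prob, S, hT, hinner]
  have h0 : 1 - S.value = 0 := by
    rw [S.one_sub_value]
    refine Finset.sum_eq_zero fun x _ => Finset.sum_eq_zero fun y _ => Finset.sum_eq_zero fun a _ =>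
      Finset.sum_eq_zero fun b _ => ?_
    by_cases hD : G.D x y a b = true
    · simp [hD]
    by_cases hμ : G.μ x y = 0
    · simp [hμ]
    have hl := (losing_desc G x y a b).2 ⟨hμ, by simpa using hD⟩
    have h1 := hm.constraint_nonneg
      (.inr (.inr (.inr (.inr (.inr (.inr ((x, a), (y, b))))))))
    simp only [constraint, hl, if_true, signedSum_cons, signedSum_nil, sgn_false] at h1
    -- The perfection constraint gives only `≤ 0`; the reverse inequality is positivity in the
    -- constructed strategy.
    have h2 : S.prob x y a b = 0 :=
      le_antisymm (by rw [hprob]; linarith) (S.prob_nonneg x y a b)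
    simp [h2]
  linarith

end NonlocalGames
end

/-! ### Finite tables of moments and compactness -/

noncomputable section

namespace NonlocalGames

open Filter Topology Encodable

/-- The entry of a word, with a sign, in the table of the `2 * N + 1`-ary digits of `t`; the
digit `N + k` stands for the value `k / N`. -/
def entry (t N : ℕ) (p : Bool × Word) : ℕ :=
  if p.1 then t / (2 * N + 1) ^ encode p.2 % (2 * N + 1)
  else 2 * N - t / (2 * N + 1) ^ encode p.2 % (2 * N + 1)

/-- The table of digits of `t` satisfies the constraint `L` approximately, if it contains all its
words. -/
def EntriesSatisfy (t N : ℕ) (L : SignedSum) : Prop :=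
  (∀ p ∈ L, encode p.2 < N) →
    L.length * N ≤ (L.map (entry t N)).sum + 2 * L.length

/-- There is a table of moments of size `N` and precision `1 / N` which satisfies the first `N`
constraints of the family `c` approximately. -/
def HasTable {ι : Type} [Primcodable ι] (c : ι → SignedSum) (N : ℕ) : Prop :=
  ∃ t < (2 * N + 1) ^ N, entry t N (true, []) = 2 * N ∧
    ∀ i < N, ∀ j ∈ (decode i : Option ι), EntriesSatisfy t N (c j)

lemma exists_digits (B : ℕ) (N : ℕ) (f : ℕ → ℕ) (hf : ∀ k, f k < B) :
    ∃ t < B ^ N, ∀ k < N, t / B ^ k % B = f k := by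
  induction N generalizing f with
  | zero => exact ⟨0, by simp, by simp⟩
  | succ N ih =>
    obtain ⟨t, ht, hft⟩ := ih (fun k => f (k + 1)) fun k => hf _
    have hB : 0 < B := (Nat.zero_le _).trans_lt (hf 0)
    -- Digits are little-endian: `f 0` is put below the number that encodes the shifted sequence.
    refine ⟨f 0 + B * t, ?_, fun k hk => ?_⟩
    · calc f 0 + B * t < B + B * t := by have := hf 0; omega
        _ = B * (t + 1) := by ring
        _ ≤ B * B ^ N := Nat.mul_le_mul_left _ ht
        _ = B ^ (N + 1) := by ring
    · cases k with
      | zero => simp [Nat.mod_eq_of_lt (hf 0)]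
      | succ k =>
        rw [pow_succ', ← Nat.div_div_eq_div_mul, Nat.add_mul_div_left _ _ hB,
          Nat.div_eq_of_lt (hf 0), zero_add]
        exact hft k (by omega)

/-- A sign reflects the digit about its centre `N`. This keeps entries natural, at the price of the
offset `L.length * N` in `EntriesSatisfy`. -/
lemma natCast_entry (t N : ℕ) (p : Bool × Word) :
    (entry t N p : ℝ) = N + sgn p.1 * (entry t N (true, p.2) - N) := by
  obtain ⟨s, w⟩ := p
  cases s
  · have h : t / (2 * N + 1) ^ encode w % (2 * N + 1) ≤ 2 * N :=
      Nat.lt_succ_iff.1 (Nat.mod_lt _ (Nat.succ_pos _))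
    simp only [entry, sgn_false, Bool.false_eq_true, if_false, if_true, Nat.cast_sub h]
    push_cast; ring
  · simp

lemma sum_entry (t N : ℕ) (L : SignedSum) :
    (((L.map (entry t N)).sum : ℕ) : ℝ) =
      L.length * N + signedSum (fun w => (entry t N (true, w) - N : ℝ)) L := by
  induction L with
  | nil => simp
  | cons p L ih =>
    simp only [List.map_cons, List.sum_cons, List.length_cons, signedSum_cons]
    rw [Nat.cast_add, ih, natCast_entry]
    push_cast; ring

lemma encode_nil_word : encode ([] : Word) = 0 := rfl

/-- The digits are the rounded values of `N * m w`, shifted by `N`. Of the slack `2 * L.length`,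
rounding uses at most one unit per word; the error `N * ε ≤ 1` fits in the rest when `L` is
nonempty. -/
lemma hasTable_of_isMoment {d : GameDesc} {m : Word → ℝ} {ε : ℝ} {N : ℕ} (hm : IsMoment d ε m)
    (hε : N * ε ≤ 1) : HasTable (constraint d) N := by
  have hfloor : ∀ w, 0 ≤ ⌊N * m w⌋ + N ∧ ⌊N * m w⌋ + N ≤ 2 * N := by
    intro w
    obtain ⟨h1, h2⟩ := abs_le.1 (hm.abs_le w)
    have hN : (0 : ℝ) ≤ N := N.cast_nonneg
    have h3 : (-N : ℤ) ≤ ⌊N * m w⌋ := Int.le_floor.2 (by push_cast; nlinarith)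
    have h4 : ⌊N * m w⌋ ≤ (N : ℤ) := by
      have : (⌊N * m w⌋ : ℝ) ≤ N := (Int.floor_le _).trans (by nlinarith)
      exact_mod_cast this
    constructor <;> linarith
  let f : ℕ → ℕ := fun k => match (decode k : Option Word) with
    | none => 0
    | some w => (⌊N * m w⌋ + N).toNat
  have hf : ∀ k, f k < 2 * N + 1 := by
    intro k
    simp only [f]
    split
    · omega
    · rename_i w _
      have := hfloor w
      omega
  obtain ⟨t, ht, hdig⟩ := exists_digits (2 * N + 1) N f hf
  have hentry : ∀ w : Word, encode w < N → (entry t N (true, w) : ℝ) - N = ⌊N * m w⌋ := by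
    intro w hw
    have h1 : entry t N (true, w) = (⌊N * m w⌋ + N).toNat := by
      simp only [entry, if_true, hdig _ hw, f, encodek]
    have h2 : ((⌊N * m w⌋ + N).toNat : ℤ) = ⌊N * m w⌋ + N := Int.toNat_of_nonneg (hfloor w).1
    rw [h1, sub_eq_iff_eq_add]
    exact_mod_cast h2
  refine ⟨t, ht, ?_, fun i _ j _ hj => ?_⟩
  · rcases Nat.eq_zero_or_pos N with rfl | hN
    · simp [entry, Nat.mod_one]
    · have h := hentry [] (by rw [encode_nil_word]; exact hN)
      rw [hm.nil, mul_one, Int.floor_natCast] at h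
      have h' : (entry t N (true, []) : ℝ) = 2 * N := by
        push_cast at h; linarith
      exact_mod_cast h'
  · have h1 : ∀ L : SignedSum, (∀ p ∈ L, encode p.2 < N) →
        N * signedSum m L - L.length ≤
          signedSum (fun w => (entry t N (true, w) - N : ℝ)) L := by
      intro L hL
      induction L with
      | nil => simp
      | cons p L ih =>
        have ih := ih fun q hq => hL q (List.mem_cons_of_mem _ hq)
        have hp := hentry p.2 (hL p List.mem_cons_self)
        simp only [signedSum_cons, List.length_cons, hp]
        push_cast
        have h2 := Int.floor_le ((N : ℝ) * m p.2)
        have h3 := Int.sub_one_lt_floor ((N : ℝ) * m p.2)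
        obtain ⟨s, w⟩ := p
        cases s <;> simp only [sgn_true, sgn_false] at h2 h3 ⊢ <;> linarith
    have h2 := h1 _ hj
    have h3 := hm.nonneg j
    generalize constraint d j = L at *
    rcases L with - | ⟨p, L⟩
    · simp
    have h4 : (1 : ℝ) ≤ ((p :: L).length : ℝ) := by
      rw [List.length_cons]; push_cast; linarith [(L.length.cast_nonneg : (0 : ℝ) ≤ L.length)]
    have h5 : (N : ℝ) * -ε ≤ N * signedSum m (p :: L) :=
      mul_le_mul_of_nonneg_left h3 N.cast_nonneg
    have h6 : ((p :: L).length * N : ℝ) ≤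
        (((p :: L).map (entry t N)).sum : ℕ) + 2 * (p :: L).length := by
      rw [sum_entry]; linarith
    exact_mod_cast h6

/-- The rescaled tables lie in the compact space `[-1, 1]^Word` and converge along a nonprincipal
ultrafilter. Each constraint is eventually among those tested, with all its words in the table, and
its error is `O(1 / N)`. -/
lemma exists_isMoment_of_hasTable {d : GameDesc} (h : ∀ N, HasTable (constraint d) N) :
    ∃ m, IsMoment d 0 m := by
  choose t _ hnil hsat using h
  let f : ℕ → Word → ℝ := fun N w => (entry (t N) N (true, w) - N) / N
  have hentry : ∀ N w, (entry (t N) N (true, w) : ℝ) ≤ 2 * N := by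
    intro N w
    have : entry (t N) N (true, w) ≤ 2 * N := Nat.lt_succ_iff.1 (Nat.mod_lt _ (Nat.succ_pos _))
    exact_mod_cast this
  have hf : ∀ N w, f N w ∈ Set.Icc (-1 : ℝ) 1 := by
    intro N w
    rcases Nat.eq_zero_or_pos N with rfl | hN
    · simp [f]
    have hN' : (0 : ℝ) < N := by exact_mod_cast hN
    have h1 := hentry N w
    have h2 : (0 : ℝ) ≤ entry (t N) N (true, w) := Nat.cast_nonneg _
    constructor
    · rw [le_div_iff₀ hN']; linarith
    · rw [div_le_iff₀ hN']; linarith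
  have hcomp : IsCompact (Set.univ.pi fun _ : Word => Set.Icc (-1 : ℝ) 1) :=
    isCompact_univ_pi fun _ => isCompact_Icc
  obtain ⟨m, hm, hlim⟩ := hcomp.ultrafilter_le_nhds ((hyperfilter ℕ).map f)
    (le_principal_iff.2 (mem_map.2 (Eventually.of_forall fun N w _ => hf N w)))
  have hlim' : ∀ w, Tendsto (fun N => f N w) (hyperfilter ℕ) (𝓝 (m w)) := fun w =>
    (tendsto_pi_nhds.1 hlim) w
  have hat : (hyperfilter ℕ : Filter ℕ) ≤ atTop := by
    rw [← Nat.cofinite_eq_atTop]; exact hyperfilter_le_cofinite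
  have hsum : ∀ L : SignedSum, Tendsto (fun N => signedSum (f N) L) (hyperfilter ℕ)
      (𝓝 (signedSum m L)) := by
    intro L
    induction L with
    | nil => simp
    | cons p L ih =>
      simp only [signedSum_cons]
      exact ((hlim' p.2).const_mul _).add ih
  refine ⟨m, ?_, fun w => abs_le.2 (hm w trivial), fun j => ?_⟩
  · refine tendsto_nhds_unique (hlim' []) (tendsto_const_nhds.congr' ?_)
    filter_upwards [hat (eventually_gt_atTop 0)] with N hN
    have hN' : (N : ℝ) ≠ 0 := by exact_mod_cast hN.ne'
    simp only [f, hnil N]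
    field_simp
    push_cast
    ring
  · rw [neg_zero]
    have h0 : Tendsto (fun N : ℕ => -(2 * (constraint d j).length / N : ℝ)) (hyperfilter ℕ)
        (𝓝 0) := by
      simpa using ((tendsto_const_div_atTop_nhds_zero_nat
        (2 * (constraint d j).length : ℝ)).neg).mono_left hat
    refine le_of_tendsto_of_tendsto h0 (hsum (constraint d j)) ?_
    have hwords : ∀ᶠ N in atTop, ∀ p ∈ constraint d j, encode p.2 < N := by
      generalize constraint d j = L
      induction L with
      | nil => simp
      | cons p L ih =>
        filter_upwards [ih, eventually_gt_atTop (encode p.2)] with N h1 h2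
        simpa [h2] using h1
    filter_upwards [hat (eventually_gt_atTop (encode j)), hat hwords] with N hN hw
    have hN' : (0 : ℝ) < N := by exact_mod_cast (Nat.zero_le _).trans_lt hN
    have h1 := hsat N (encode j) hN j (by simp) hw
    have h2 : ((constraint d j).length * N : ℝ) ≤
        (((constraint d j).map (entry (t N) N)).sum : ℕ) + 2 * (constraint d j).length := by
      exact_mod_cast h1
    rw [sum_entry] at h2
    have h3 : ∀ L : SignedSum, signedSum (f N) L =
        signedSum (fun w => (entry (t N) N (true, w) - N : ℝ)) L / N := by
      intro L
      induction L with
      | nil => simp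
      | cons p L ih => simp only [signedSum_cons, ih, f]; ring
    rw [h3, ← neg_div, div_le_div_iff_of_pos_right hN']
    linarith

/-- A game has value one if and only if it has tables of moments of all sizes. -/
theorem coValue_eq_one_iff (G : Game) : G.coValue = 1 ↔ ∀ N, HasTable (constraint G.desc) N := by
  refine ⟨fun h N => ?_, fun h => ?_⟩
  · obtain ⟨m, hm⟩ := exists_isMoment_of_coValue h (ε := 1 / (N + 1)) (by positivity)
    refine hasTable_of_isMoment hm ?_
    rw [mul_one_div, div_le_one (by positivity)]
    linarith
  · obtain ⟨m, hm⟩ := exists_isMoment_of_hasTable h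
    exact coValue_eq_one_of_isMoment hm

end NonlocalGames
end

/-! ### Primitive recursiveness of the constraints and of the table search -/

noncomputable section

namespace NonlocalGames

open Primrec Encodable

lemma primrec₂_pow : Primrec₂ ((· ^ ·) : ℕ → ℕ → ℕ) :=
  Primrec₂.unpaired'.1 Nat.Primrec.pow

lemma primrec_list_sum : Primrec (List.sum : List ℕ → ℕ) :=
  (list_foldr Primrec.id (Primrec.const 0)
    (nat_add.comp (fst.comp snd) (snd.comp snd)).to₂).of_eq fun L => by
      simp [List.sum]

lemma primrec₂_conjugate : Primrec₂ conjugate := by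
  have h : Primrec₂ fun (r : (Word × SignedSum) × (Bool × Word)) (q : Bool × Word) =>
      (r.2.1 == q.1, r.2.2.reverse ++ (r.1.1 ++ q.2)) :=
    (Primrec.beq.comp (fst.comp (snd.comp fst)) (fst.comp snd)).pair
      (list_append.comp (list_reverse.comp (snd.comp (snd.comp fst)))
        (list_append.comp (fst.comp (fst.comp fst)) (snd.comp snd)))
  exact list_flatMap snd (list_map (snd.comp fst) h)

lemma primrec_negate : Primrec negate :=
  list_map Primrec.id ((Primrec.not.comp (fst.comp snd)).pair (snd.comp snd)).to₂

lemma primrec_losing :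
    Primrec fun p : GameDesc × (ℕ × ℕ) × (ℕ × ℕ) => losing p.1 p.2.1.1 p.2.2.1 p.2.1.2 p.2.2.2 := by
  have hμ : Primrec fun p : GameDesc × (ℕ × ℕ) × (ℕ × ℕ) =>
      ((p.1.2.2.1.getD p.2.1.1 []).getD p.2.2.1 (0, 1)).1 :=
    fst.comp ((list_getD _).comp ((list_getD _).comp (fst.comp (snd.comp (snd.comp fst)))
      (fst.comp (fst.comp snd))) (fst.comp (snd.comp snd)))
  have hD : Primrec fun p : GameDesc × (ℕ × ℕ) × (ℕ × ℕ) =>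
      ((((p.1.2.2.2.getD p.2.1.1 []).getD p.2.2.1 []).getD p.2.1.2 []).getD p.2.2.2 true) :=
    (list_getD _).comp ((list_getD _).comp ((list_getD _).comp ((list_getD _).comp
      (snd.comp (snd.comp (snd.comp fst))) (fst.comp (fst.comp snd))) (fst.comp (snd.comp snd)))
      (snd.comp (fst.comp snd))) (snd.comp (snd.comp snd))
  exact Primrec.and.comp (Primrec.not.comp (Primrec.beq.comp hμ (Primrec.const 0)))
    (Primrec.not.comp hD)

lemma primrec₂_constraint_povm :
    Primrec₂ fun (d : GameDesc) (q : Bool × Bool × ℕ × Word × Word) =>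
    if q.2.2.1 < d.1 then
      (!q.1, q.2.2.2.1 ++ q.2.2.2.2) :: (List.range d.2.1).map fun a =>
        (q.1, q.2.2.2.1 ++ (q.2.1, q.2.2.1, a) :: q.2.2.2.2)
    else [] := by
  have hs : Primrec fun r : GameDesc × Bool × Bool × ℕ × Word × Word => r.2.1 := fst.comp snd
  have ht : Primrec fun r : GameDesc × Bool × Bool × ℕ × Word × Word => r.2.2.1 :=
    fst.comp (snd.comp snd)
  have hx : Primrec fun r : GameDesc × Bool × Bool × ℕ × Word × Word => r.2.2.2.1 :=
    fst.comp (snd.comp (snd.comp snd))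
  have hu : Primrec fun r : GameDesc × Bool × Bool × ℕ × Word × Word => r.2.2.2.2.1 :=
    fst.comp (snd.comp (snd.comp (snd.comp snd)))
  have hv : Primrec fun r : GameDesc × Bool × Bool × ℕ × Word × Word => r.2.2.2.2.2 :=
    snd.comp (snd.comp (snd.comp (snd.comp snd)))
  have hm : Primrec₂ fun (r : GameDesc × Bool × Bool × ℕ × Word × Word) (a : ℕ) =>
      (r.2.1, r.2.2.2.2.1 ++ (r.2.2.1, r.2.2.2.1, a) :: r.2.2.2.2.2) :=
    (hs.comp fst).pair (list_append.comp (hu.comp fst) (list_cons.comp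
      ((ht.comp fst).pair ((hx.comp fst).pair snd)) (hv.comp fst)))
  exact Primrec.ite (nat_lt.comp hx (fst.comp fst))
    (list_cons.comp ((Primrec.not.comp hs).pair (list_append.comp hu hv))
      (list_map (list_range.comp (fst.comp (snd.comp fst))) hm)) (Primrec.const [])

lemma primrec₂_constraint_losing :
    Primrec₂ fun (d : GameDesc) (q : (ℕ × ℕ) × (ℕ × ℕ)) =>
    if losing d q.1.1 q.2.1 q.1.2 q.2.2 then [(false, [(true, q.1), (false, q.2)])]
    else [] := by
  have hl : Primrec fun r : GameDesc × (ℕ × ℕ) × (ℕ × ℕ) =>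
      losing r.1 r.2.1.1 r.2.2.1 r.2.1.2 r.2.2.2 :=
    primrec_losing.comp (fst.pair snd)
  have hw : Primrec fun q : (ℕ × ℕ) × (ℕ × ℕ) => ([(true, q.1), (false, q.2)] : Word) :=
    list_cons.comp ((Primrec.const true).pair fst)
      (list_cons.comp ((Primrec.const false).pair snd) (Primrec.const []))
  have hL : Primrec fun q : (ℕ × ℕ) × (ℕ × ℕ) =>
      ([(false, [(true, q.1), (false, q.2)])] : SignedSum) :=
    list_cons.comp ((Primrec.const false).pair hw) (Primrec.const [])
  exact Primrec.ite (Primrec.eq.comp hl (Primrec.const true)) (hL.comp snd) (Primrec.const [])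

lemma primrec₂_sumElim {α β γ σ : Type} [Primcodable α] [Primcodable β] [Primcodable γ]
    [Primcodable σ] {g : α → β → σ} {h : α → γ → σ} (hg : Primrec₂ g) (hh : Primrec₂ h) :
    Primrec₂ fun a => Sum.elim (g a) (h a) :=
  (sumCasesOn snd (hg.comp (fst.comp fst) snd).to₂ (hh.comp (fst.comp fst) snd).to₂).of_eq
    fun p => by rcases p with ⟨a, b | c⟩ <;> rfl

lemma primrec₂_constraint : Primrec₂ constraint := by
  have h1 : Primrec₂ fun (_ : GameDesc) (L : SignedSum) => conjugate [] L :=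
    (primrec₂_conjugate.comp (Primrec.const []) snd).to₂
  have h2 :
      Primrec₂ fun (_ : GameDesc) (q : Letter × SignedSum) => conjugate [q.1] q.2 :=
    (primrec₂_conjugate.comp (list_cons.comp (fst.comp snd) (Primrec.const []))
      (snd.comp snd)).to₂
  have h3 : Primrec₂ fun (_ : GameDesc) (q : Letter × SignedSum) =>
      conjugate [] q.2 ++ negate (conjugate [q.1, q.1] q.2) :=
    (list_append.comp (primrec₂_conjugate.comp (Primrec.const []) (snd.comp snd))
      (primrec_negate.comp (primrec₂_conjugate.comp
        (list_cons.comp (fst.comp snd) (list_cons.comp (fst.comp snd) (Primrec.const [])))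
        (snd.comp snd)))).to₂
  have h4 : Primrec₂ fun (_ : GameDesc) (q : Bool × Word) =>
      [(q.1, q.2), (!q.1, q.2.reverse)] :=
    (list_cons.comp snd (list_cons.comp ((Primrec.not.comp (fst.comp snd)).pair
      (list_reverse.comp (snd.comp snd))) (Primrec.const []))).to₂
  have h5 :
      Primrec₂ fun (_ : GameDesc) (q : Bool × (ℕ × ℕ) × (ℕ × ℕ) × Word × Word) =>
      [(q.1, q.2.2.2.1 ++ (true, q.2.1) :: (false, q.2.2.1) :: q.2.2.2.2),
        (!q.1, q.2.2.2.1 ++ (false, q.2.2.1) :: (true, q.2.1) :: q.2.2.2.2)] := by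
    have hp : Primrec fun r : GameDesc × Bool × (ℕ × ℕ) × (ℕ × ℕ) × Word × Word => r.2.2.1 :=
      fst.comp (snd.comp snd)
    have hq : Primrec fun r : GameDesc × Bool × (ℕ × ℕ) × (ℕ × ℕ) × Word × Word => r.2.2.2.1 :=
      fst.comp (snd.comp (snd.comp snd))
    have hu : Primrec fun r : GameDesc × Bool × (ℕ × ℕ) × (ℕ × ℕ) × Word × Word => r.2.2.2.2.1 :=
      fst.comp (snd.comp (snd.comp (snd.comp snd)))
    have hv : Primrec fun r : GameDesc × Bool × (ℕ × ℕ) × (ℕ × ℕ) × Word × Word => r.2.2.2.2.2 :=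
      snd.comp (snd.comp (snd.comp (snd.comp snd)))
    have hA := (Primrec.const true).pair hp
    have hB := (Primrec.const false).pair hq
    exact (list_cons.comp
      ((fst.comp snd).pair (list_append.comp hu (list_cons.comp hA (list_cons.comp hB hv))))
      (list_cons.comp ((Primrec.not.comp (fst.comp snd)).pair
        (list_append.comp hu (list_cons.comp hB (list_cons.comp hA hv)))) (Primrec.const []))).to₂
  refine (primrec₂_sumElim h1 (primrec₂_sumElim h2 (primrec₂_sumElim h3 (primrec₂_sumElim h4
    (primrec₂_sumElim h5 (primrec₂_sumElim primrec₂_constraint_povm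
      primrec₂_constraint_losing)))))).of_eq ?_
  rintro d (L | ⟨g, L⟩ | ⟨g, L⟩ | ⟨s, w⟩ | ⟨s, p, q, u, v⟩ | ⟨s, t, x, u, v⟩ | ⟨p, q⟩) <;> rfl

lemma primrec_entry : Primrec fun p : (ℕ × ℕ) × (Bool × Word) => entry p.1.1 p.1.2 p.2 := by
  have hB : Primrec fun p : (ℕ × ℕ) × (Bool × Word) => 2 * p.1.2 :=
    nat_mul.comp (Primrec.const 2) (snd.comp fst)
  have hB' := Primrec.succ.comp hB
  have hdig : Primrec fun p : (ℕ × ℕ) × (Bool × Word) =>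
      p.1.1 / (2 * p.1.2 + 1) ^ encode p.2.2 % (2 * p.1.2 + 1) :=
    nat_mod.comp (nat_div.comp (fst.comp fst)
      (primrec₂_pow.comp hB' (Primrec.encode.comp (snd.comp snd)))) hB'
  exact Primrec.ite (Primrec.eq.comp (fst.comp snd) (Primrec.const true)) hdig
    (nat_sub.comp hB hdig)

lemma primrecRel_entriesSatisfy :
    PrimrecRel fun (p : ℕ × ℕ) (L : SignedSum) => EntriesSatisfy p.1 p.2 L := by
  have h1 : PrimrecRel fun (p : Bool × Word) (N : ℕ) => encode p.2 < N :=
    nat_lt.comp (Primrec.encode.comp (snd.comp fst)) snd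
  have h2 : PrimrecPred fun q : (ℕ × ℕ) × SignedSum => ∀ p ∈ q.2, encode p.2 < q.1.2 :=
    h1.forall_mem_list.comp snd (snd.comp fst)
  have h3 : PrimrecPred fun q : (ℕ × ℕ) × SignedSum =>
      q.2.length * q.1.2 ≤ (q.2.map (entry q.1.1 q.1.2)).sum + 2 * q.2.length :=
    nat_le.comp (nat_mul.comp (list_length.comp snd) (snd.comp fst))
      (nat_add.comp (primrec_list_sum.comp
        (list_map snd (primrec_entry.comp ((fst.comp fst).pair snd)).to₂))
        (nat_mul.comp (Primrec.const 2) (list_length.comp snd)))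
  exact (h2.not.or h3).of_eq fun q => imp_iff_not_or.symm

/-- All quantifiers are bounded: tables range below `(2 * N + 1) ^ N`, and constraints over the
indices with code below `N`. -/
lemma primrecRel_hasTable {α ι : Type} [Primcodable α] [Primcodable ι] {c : α → ι → SignedSum}
    (hc : Primrec₂ c) : PrimrecRel fun a N => HasTable (c a) N := by
  have h1 : PrimrecRel fun (j : ι) (q : ℕ × α × ℕ) => EntriesSatisfy q.1 q.2.2 (c q.2.1 j) :=
    primrecRel_entriesSatisfy.comp ((fst.comp snd).pair (snd.comp (snd.comp snd)))
      (hc.comp (fst.comp (snd.comp snd)) fst)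
  have h2 : PrimrecRel fun (i : ℕ) (q : ℕ × α × ℕ) =>
      ∀ j ∈ (decode i : Option ι).toList, EntriesSatisfy q.1 q.2.2 (c q.2.1 j) :=
    h1.forall_mem_list.comp (optionToList.comp (Primrec.decode.comp fst)) snd
  have h3 : PrimrecRel fun (t : ℕ) (r : α × ℕ) => entry t r.2 (true, []) = 2 * r.2 ∧
      ∀ i ∈ List.range r.2, ∀ j ∈ (decode i : Option ι).toList,
        EntriesSatisfy t r.2 (c r.1 j) := by
    refine PrimrecPred.and ?_ ?_
    · exact Primrec.eq.comp
        (primrec_entry.comp ((fst.pair (snd.comp snd)).pair (Primrec.const (true, []))))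
        (nat_mul.comp (Primrec.const 2) (snd.comp snd))
    · exact h2.forall_mem_list.comp (list_range.comp (snd.comp snd)) Primrec.id
  have h4 : PrimrecPred fun r : α × ℕ => ∃ t ∈ List.range ((2 * r.2 + 1) ^ r.2),
      entry t r.2 (true, []) = 2 * r.2 ∧
      ∀ i ∈ List.range r.2, ∀ j ∈ (decode i : Option ι).toList,
        EntriesSatisfy t r.2 (c r.1 j) :=
    h3.exists_mem_list.comp (list_range.comp (primrec₂_pow.comp
      (Primrec.succ.comp (nat_mul.comp (Primrec.const 2) snd)) snd)) Primrec.id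
  exact h4.of_eq fun r => by simp [HasTable]

/-! ### The `Π₁` language of perfect sequences, and compression -/

/-- The programs all of whose outputs describe games of value one. -/
def perfectSequences : Set ℕ :=
  {k | ∀ n s N, ∀ d ∈ ((Denumerable.ofNat Nat.Partrec.Code k).evaln s n).bind
    (decode (α := GameDesc)), HasTable (constraint d) N}

/-- Bounding the running time makes the evaluation decidable. The universal variable `x` encodes the
triple of the input `n`, the step bound `s` and the table size `N`. -/
lemma isPiOne_perfectSequences : IsPiOne perfectSequences := by
  refine ⟨fun k x => ∀ d ∈ ((Denumerable.ofNat Nat.Partrec.Code k).evaln x.unpair.2.unpair.1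
    x.unpair.1).bind (decode (α := GameDesc)), HasTable (constraint d) x.unpair.2.unpair.2, ?_, fun k => ?_⟩
  · have hx : Primrec fun q : ℕ × ℕ => q.2.unpair := Primrec.unpair.comp snd
    have hx' : Primrec fun q : ℕ × ℕ => q.2.unpair.2.unpair := Primrec.unpair.comp (snd.comp hx)
    have he : Primrec fun q : ℕ × ℕ => ((Denumerable.ofNat Nat.Partrec.Code q.1).evaln
        q.2.unpair.2.unpair.1 q.2.unpair.1).bind (decode (α := GameDesc)) :=
      option_bind (Nat.Partrec.Code.primrec_evaln.comp
        (((fst.comp hx').pair ((Primrec.ofNat _).comp fst)).pair (fst.comp hx)))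
        (Primrec.decode.comp snd).to₂
    have h : PrimrecPred fun q : ℕ × ℕ => ∀ d ∈
        (((Denumerable.ofNat Nat.Partrec.Code q.1).evaln q.2.unpair.2.unpair.1 q.2.unpair.1).bind
          (decode (α := GameDesc))).toList, HasTable (constraint d) q.2.unpair.2.unpair.2 :=
      (primrecRel_hasTable primrec₂_constraint).forall_mem_list.comp (optionToList.comp he) (snd.comp hx')
    obtain ⟨_, h⟩ := h.of_eq (q := fun q : ℕ × ℕ => ∀ d ∈
        ((Denumerable.ofNat Nat.Partrec.Code q.1).evaln q.2.unpair.2.unpair.1 q.2.unpair.1).bind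
          (decode (α := GameDesc)), HasTable (constraint d) q.2.unpair.2.unpair.2) fun q => by
      simp only [Option.mem_toList]; rfl
    exact ⟨_, h.to_comp⟩
  · refine ⟨fun h x => h _ _ _, fun h n s N => ?_⟩
    simpa using h (Nat.pair n (Nat.pair s N))

/-- Since `c` halts on `n`, some step bound reveals the description of `𝒢 n`, and by soundness no
bounded run reveals anything else. -/
lemma encode_mem_perfectSequences {c : Nat.Partrec.Code} {𝒢 : ℕ → Game}
    (h : DescribesSeq c 𝒢) : encode c ∈ perfectSequences ↔ ∀ n, (𝒢 n).coValue = 1 := by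
  simp only [perfectSequences, Set.mem_ofPred_eq, Denumerable.ofNat_encode, coValue_eq_one_iff]
  constructor
  · intro H n N
    have hn : encode (𝒢 n).desc ∈ c.eval n := by rw [h n]; exact Part.mem_some _
    obtain ⟨s, hs⟩ := Nat.Partrec.Code.evaln_complete.1 hn
    exact H n s N _ (Option.bind_eq_some_iff.2 ⟨_, hs, encodek _⟩)
  · intro H n s N d hd
    obtain ⟨e, he, hd⟩ := Option.bind_eq_some_iff.1 (Option.mem_def.1 hd)
    have he' := Nat.Partrec.Code.evaln_sound (Option.mem_def.2 he)
    rw [h n, Part.mem_some_iff] at he'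
    rw [he', encodek, Option.some_inj] at hd
    exact hd ▸ H n N

/-- If the promise problem `(yes, no)` is `Π₁`-hard, sequences of games can be compressed to single
games, so that perfect sequences go to yes-instances and the other ones to no-instances. -/
lemma exists_compress {yes no : Set Game} (h : IsPiOneHard yes no) :
    ∃ f : Nat.Partrec.Code → Game, ComputableToGames f ∧
      ∀ (c : Nat.Partrec.Code) (𝒢 : ℕ → Game), DescribesSeq c 𝒢 →
        ((∀ n, (𝒢 n).coValue = 1) → f c ∈ yes) ∧ ((¬ ∀ n, (𝒢 n).coValue = 1) → f c ∈ no) := by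
  obtain ⟨f, hf, H⟩ := h _ isPiOne_perfectSequences
  refine ⟨fun c => f (encode c), Computable.comp (f := fun n => (f n).desc) hf Computable.encode,
    fun c 𝒢 hc => ?_⟩
  rw [← encode_mem_perfectSequences hc]
  exact H (encode c)

end NonlocalGames
end

theorem mainTheorem11 (𝒦 : Set NonlocalGames.Game)
    (h𝒦 : 𝒦 = Set.univ ∨ 𝒦 = {G | G.IsSynchronous ∧ G.IsUniform}) :
    (NonlocalGames.ApproxCoValuePiOneHard 𝒦 →
      ∃ GapCompress : Nat.Partrec.Code → NonlocalGames.Game,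
        NonlocalGames.ComputableToGames GapCompress ∧
        ∀ (c : Nat.Partrec.Code) (𝒢 : ℕ → NonlocalGames.Game),
          NonlocalGames.DescribesSeq c 𝒢 →
          GapCompress c ∈ 𝒦 ∧
          ((∀ n, (𝒢 n).coValue = 1) → (GapCompress c).coValue = 1) ∧
          ((¬ ∀ n, (𝒢 n).coValue = 1) → (GapCompress c).coValue < 1 / 2)) ∧
    (NonlocalGames.ExactCoValuePiOneHard 𝒦 →
      ∃ GaplessCompress : Nat.Partrec.Code → NonlocalGames.Game,
        NonlocalGames.ComputableToGames GaplessCompress ∧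
        ∀ (c : Nat.Partrec.Code) (𝒢 : ℕ → NonlocalGames.Game),
          NonlocalGames.DescribesSeq c 𝒢 →
          GaplessCompress c ∈ 𝒦 ∧
          ((GaplessCompress c).coValue = 1 ↔ ∀ n, (𝒢 n).coValue = 1)) := by
  constructor
  · intro h
    obtain ⟨f, hf, H⟩ := NonlocalGames.exists_compress h
    refine ⟨f, hf, fun c 𝒢 hc => ?_⟩
    obtain ⟨hyes, hno⟩ := H c 𝒢 hc
    refine ⟨?_, fun h1 => (hyes h1).2, fun h1 => (hno h1).2.trans_eq (by norm_num)⟩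
    -- Yes- and no-instances both belong to `𝒦`, so membership follows in either case.
    by_cases h1 : ∀ n, (𝒢 n).coValue = 1
    · exact (hyes h1).1
    · exact (hno h1).1
  · intro h
    obtain ⟨f, hf, H⟩ := NonlocalGames.exists_compress h
    refine ⟨f, hf, fun c 𝒢 hc => ?_⟩
    obtain ⟨hyes, hno⟩ := H c 𝒢 hc
    by_cases h1 : ∀ n, (𝒢 n).coValue = 1
    · exact ⟨(hyes h1).1, fun _ => h1, fun _ => (hyes h1).2⟩
    · have h2 := (hno h1).2
      rw [sub_zero] at h2
      exact ⟨(hno h1).1, fun h3 => absurd h3 h2.ne, fun h3 => absurd h3 h1⟩
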